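/- Theorem. Write $x^y = y^{-1}xy$ and $[x,y]=x^{-1}y^{-1}xy$, and let $G$ be the group presented by $$\langle\, a,s,t \mid a^2=1,\ [a,a^t]=1,\ [s,t]=1,\ a^s = a\,a^t \,\rangle .$$ Then $G$ is finitely presented and infinite, and $\mathcal A=\{a,s,t,at,ta,ata,as,sa,asa\}$ is a finite generating set of $G$. For a group $H$ with generating set $A$, let $d_A$ be the word metric, so that $d_A(1,h)$ is the least length of a word in $A\cup A^{-1}$ representing $h$ (the word length of $h$); for $H$ infinite and $A$ finite, the (dead-end) depth of $g\in H$ with respect to $A$ is the distance $d_A$ from $g$ to the complement of the closed ball of radius $d_A(1,g)$ centred at $1$. For each integer $n\ge 1$ the element $$g_n = s^n a s^{-n} t^n a t^{-2n} a t^n \in G$$ has word length exactly $6n$ and depth at least $n$ with respect to $\mathcal A$. Consequently $G$ has unbounded dead-end depth with respect to $\mathcal A$: for every $N$ there is an element of $G$ of depth at least $N$. In particular, it is not true that for every infinite finitely presented group and every finite generating set of it there is an upper bound on the dead-end depth of its elements, which answers Bogopol'skiĭ's question in the negative. -/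

import Mathlib

namespace DeadEnd

section General

variable {H : Type*} [Group H]

/-- Length of `h` with respect to the generating set `A`: the least length of a word in the
letters of `A` and their inverses that represents `h`. (It is `0` if there is no such word,
which cannot happen when `A` generates `H`.) -/
noncomputable def wordLength (A : Set H) (h : H) : ℕ :=
  sInf {k : ℕ | ∃ w : List H, (∀ x ∈ w, x ∈ A ∨ x⁻¹ ∈ A) ∧ w.prod = h ∧ w.length = k}

/-- The word metric of `H` with respect to the generating set `A`. -/
noncomputable def wordDist (A : Set H) (g h : H) : ℕ :=
  wordLength A (g⁻¹ * h)

/-- Depth of `g` with respect to `A`: the distance, in the word metric, from `g` to the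
complement of the closed ball of radius `d(1, g)` centred at `1`. This is used for infinite `H`
and finite generating sets `A`, for which the complement is non-empty. -/
noncomputable def deadEndDepth (A : Set H) (g : H) : ℕ :=
  sInf {k : ℕ | ∃ h : H, wordDist A 1 g < wordDist A 1 h ∧ wordDist A g h = k}

/-- The conjugate `x ^ y = y⁻¹ x y`. -/
def conjBy (x y : H) : H := y⁻¹ * x * y

/-- The commutator `[x, y] = x⁻¹ y⁻¹ x y`. -/
def comm (x y : H) : H := x⁻¹ * y⁻¹ * x * y

end General

/-- The three letters of the presentation. -/
inductive Letter
  | a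
  | s
  | t

section Presentation

/-- The relators of `⟨a, s, t ∣ a² = 1, [a, aᵗ] = 1, [s, t] = 1, aˢ = a aᵗ⟩`. -/
def relators : Set (FreeGroup Letter) :=
  let a := FreeGroup.of Letter.a
  let s := FreeGroup.of Letter.s
  let t := FreeGroup.of Letter.t
  {a ^ 2, comm a (conjBy a t), comm s t, conjBy a s * (a * conjBy a t)⁻¹}

end Presentation

/-- The group `⟨a, s, t ∣ a² = 1, [a, aᵗ] = 1, [s, t] = 1, aˢ = a aᵗ⟩`. -/
abbrev G : Type := PresentedGroup relators

/-- The generator `a` of `G`. -/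
def a : G := PresentedGroup.of Letter.a

/-- The generator `s` of `G`. -/
def s : G := PresentedGroup.of Letter.s

/-- The generator `t` of `G`. -/
def t : G := PresentedGroup.of Letter.t

/-- The generating set `{a, s, t, at, ta, ata, as, sa, asa}` of `G`. -/
def genSet : Set G :=
  {a, s, t, a * t, t * a, a * t * a, a * s, s * a, a * s * a}

/-- The element `sⁿ a s⁻ⁿ tⁿ a t⁻²ⁿ a tⁿ` of `G`. -/
def gElt (n : ℕ) : G :=
  s ^ n * a * (s ^ n)⁻¹ * t ^ n * a * (t ^ (2 * n))⁻¹ * a * t ^ n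

end DeadEnd

/-!
Elements of `G` are configurations of a lamplighter on the grid `ℤ × ℤ`: `s` and `t` move by
`(1, 0)` and `(0, 1)`, and `a` toggles the lamp at the current position. All lamps commute and are
involutions (`commute_lamp`, `lamp_mul_self`), and they satisfy
`lamp (i - 1, j) = lamp (i, j) * lamp (i, j - 1)`. Since the letters of `genSet` are moves with
optional toggles before and after, the length of an element other than `a` is the length of a
shortest walk to its position that passes through enough lamps to generate its configuration. The
element `gElt n` ends at the origin with the lamps at `(n, 0)`, `(0, n)` and `(0, -n)` lit.

*Upper bound.* Multiplying `gElt n` by a word of length at most `n` yields a configuration of lamps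
in the triangle `i ≤ n`, `j ≤ n`, `i + j ≥ -n`, at a position `p` near the origin. Because of the
relation between lamps, the lamps on a tripod, that is, on three straight legs from a point to the
three sides, generate all lamps of the triangle (`lampSubgroup_tripod`). The legs have total length
`3 n`, and some tripod contains both the origin and `p`, so a walk of length at most `6 n` around
it suffices (`wordLength_le_of_mem_triangle`). Hence nothing near `gElt n` is longer than `6 n`.

*Lower bound.* `G` acts on `𝔽₂(x)` by affine maps, the lamp at `(i, j)` as the translation by
`(1 + x) ^ (-i) * x ^ (-j)`. The configuration of `gElt n` gives `(1 + x) ^ (-n) + x ^ (-n) + x ^ n`, which has poles of order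
`n` at `x = 1`, at `x = 0` and at infinity. The order of the pole of a lamp at these places is
`i`, `j` and `-i - j`, respectively, so a word for `gElt n` visits all three sides of the
triangle (`exists_prefixes`), and a closed walk that does so has length at least `6 n`
(`six_mul_le_length`).
-/

namespace DeadEnd

/-! ### Lamps and their relations -/

theorem a_sq : a * a = 1 := by
  have h : PresentedGroup.mk relators (FreeGroup.of Letter.a ^ 2) = 1 :=
    PresentedGroup.one_of_mem (by simp [relators])
  rw [map_pow, pow_two] at h
  exact h

theorem a_inv : a⁻¹ = a := inv_eq_of_mul_eq_one_left a_sq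

theorem commute_a_conj : Commute a (t⁻¹ * a * t) := by
  have h : PresentedGroup.mk relators
      (comm (.of Letter.a) (conjBy (.of Letter.a) (.of Letter.t))) = 1 :=
    PresentedGroup.one_of_mem (by simp [relators])
  simp only [comm, conjBy, map_mul, map_inv] at h
  change a⁻¹ * (t⁻¹ * a * t)⁻¹ * a * (t⁻¹ * a * t) = 1 at h
  rw [mul_assoc, ← mul_inv_rev, inv_mul_eq_one] at h
  exact h.symm

theorem commute_s_t : Commute s t := by
  have h : PresentedGroup.mk relators (comm (.of Letter.s) (.of Letter.t)) = 1 :=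
    PresentedGroup.one_of_mem (by simp [relators])
  simp only [comm, map_mul, map_inv] at h
  change s⁻¹ * t⁻¹ * s * t = 1 at h
  rw [mul_assoc, ← mul_inv_rev, inv_mul_eq_one] at h
  exact h.symm

theorem conj_a_s : s⁻¹ * a * s = a * (t⁻¹ * a * t) := by
  have h : PresentedGroup.mk relators (conjBy (.of Letter.a) (.of Letter.s) *
      (.of Letter.a * conjBy (.of Letter.a) (.of Letter.t))⁻¹) = 1 :=
    PresentedGroup.one_of_mem (by simp [relators])
  simp only [conjBy, map_mul, map_inv] at h
  exact mul_inv_eq_one.mp h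

/-- The element `s ^ i * t ^ j` that moves the lamplighter by `(i, j)`. -/
def shift (p : ℤ × ℤ) : G := s ^ p.1 * t ^ p.2

theorem shift_add (p q : ℤ × ℤ) : shift (p + q) = shift p * shift q := by
  simp only [shift, Prod.fst_add, Prod.snd_add, zpow_add]
  rw [mul_assoc, mul_assoc, ← mul_assoc (s ^ q.1), ← mul_assoc (t ^ p.2),
    (commute_s_t.zpow_zpow q.1 p.2).eq]

@[simp] theorem shift_zero : shift 0 = 1 := by simp [shift]

theorem shift_neg (p : ℤ × ℤ) : shift (-p) = (shift p)⁻¹ :=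
  eq_inv_of_mul_eq_one_left (by rw [← shift_add]; simp)

/-- The conjugate of `a` that toggles the lamp at position `p`. -/
def lamp (p : ℤ × ℤ) : G := shift p * a * (shift p)⁻¹

theorem lamp_mul_self (p : ℤ × ℤ) : lamp p * lamp p = 1 := by
  rw [lamp, mul_assoc, ← mul_assoc (shift p)⁻¹, ← mul_assoc (shift p)⁻¹, inv_mul_cancel, one_mul,
    ← mul_assoc, mul_assoc (shift p), a_sq, mul_one, mul_inv_cancel]

theorem shift_mul_a (p : ℤ × ℤ) : shift p * a = lamp p * shift p := by
  simp [lamp]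

theorem conj_lamp (p q : ℤ × ℤ) : MulAut.conj (shift p) (lamp q) = lamp (p + q) := by
  simp [lamp, shift_add, mul_assoc]

/-- The relation `aˢ = a aᵗ`, translated to every position. -/
theorem lamp_left (i j : ℤ) : lamp (i - 1, j) = lamp (i, j) * lamp (i, j - 1) := by
  have h : lamp (-1, 0) = lamp (0, 0) * lamp (0, -1) := by
    simpa [lamp, shift] using conj_a_s
  have h2 := congrArg (MulAut.conj (shift (i, j))) h
  rw [map_mul, conj_lamp, conj_lamp, conj_lamp] at h2
  simpa [sub_eq_add_neg] using h2

/-- Lamps in one row commute. If lamps at distance at most `k + 1` commute in every row, then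
translating this to the next row says that a product of two neighbouring lamps commutes with
another such product; all but one of the four commutations involved are known, hence so is the
last, which is at distance `k + 2`. -/
theorem commute_lamp_row (k : ℕ) : ∀ i j : ℤ, Commute (lamp (i, j)) (lamp (i, j - k)) := by
  induction k using Nat.twoStepInduction with
  | zero => intro i j; simp
  | one =>
    intro i j
    have h : Commute (lamp (0, 0)) (lamp (0, -1)) := by
      simpa [lamp, shift] using commute_a_conj
    have h2 := h.map (MulAut.conj (shift (i, j)))
    rw [conj_lamp, conj_lamp] at h2
    simpa [sub_eq_add_neg] using h2
  | more k ih₀ ih₁ =>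
    intro i j
    have hAC := ih₁ i j
    have hBC := ih₀ i (j - 1)
    have hBD := ih₁ i (j - 1)
    have hABCD := ih₁ (i - 1) j
    rw [lamp_left, lamp_left] at hABCD
    push_cast at *
    rw [show j - 1 - (k : ℤ) = j - (k + 1) by ring] at hBC
    rw [show j - 1 - ((k : ℤ) + 1) = j - (k + 2) by ring] at hBD
    rw [show j - ((k : ℤ) + 1) - 1 = j - (k + 2) by ring] at hABCD
    have hABC := hAC.mul_left hBC
    have hABD := hABC.inv_right.mul_right hABCD
    rw [inv_mul_cancel_left] at hABD
    have hAD := hABD.mul_left hBD.inv_left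
    rwa [mul_inv_cancel_right] at hAD

theorem commute_lamp_of_le (m : ℕ) :
    ∀ i j j' : ℤ, Commute (lamp (i, j)) (lamp (i - m, j')) := by
  induction m with
  | zero =>
    intro i j j'
    rcases le_total j' j with h | h
    · obtain ⟨k, hk⟩ := Int.eq_ofNat_of_zero_le (sub_nonneg.2 h)
      have := commute_lamp_row k i j
      rw [← hk] at this
      simpa using this
    · obtain ⟨k, hk⟩ := Int.eq_ofNat_of_zero_le (sub_nonneg.2 h)
      have := commute_lamp_row k i j'
      rw [← hk] at this
      simpa using this.symm
  | succ m ih =>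
    intro i j j'
    have : i - ((m + 1 : ℕ) : ℤ) = i - m - 1 := by push_cast; ring
    rw [this, lamp_left]
    exact (ih i j j').mul_right (ih i j (j' - 1))

theorem commute_lamp (p q : ℤ × ℤ) : Commute (lamp p) (lamp q) := by
  obtain ⟨i, j⟩ := p
  obtain ⟨i', j'⟩ := q
  rcases le_total i' i with h | h
  · obtain ⟨k, hk⟩ := Int.eq_ofNat_of_zero_le (sub_nonneg.2 h)
    have := commute_lamp_of_le k i j j'
    rw [← hk] at this
    simpa using this
  · obtain ⟨k, hk⟩ := Int.eq_ofNat_of_zero_le (sub_nonneg.2 h)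
    have := commute_lamp_of_le k i' j' j
    rw [← hk] at this
    simpa using this.symm

/-- The subgroup generated by the lamps at the positions in `S`. -/
def lampSubgroup (S : Set (ℤ × ℤ)) : Subgroup G := Subgroup.closure (lamp '' S)

theorem lamp_mem {S : Set (ℤ × ℤ)} {p : ℤ × ℤ} (h : p ∈ S) : lamp p ∈ lampSubgroup S :=
  Subgroup.subset_closure ⟨p, h, rfl⟩

theorem lampSubgroup_mono {S T : Set (ℤ × ℤ)} (h : S ⊆ T) : lampSubgroup S ≤ lampSubgroup T :=
  Subgroup.closure_mono (Set.image_mono h)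

theorem commute_lamp_of_mem {S : Set (ℤ × ℤ)} {ν : G} (h : ν ∈ lampSubgroup S) (p : ℤ × ℤ) :
    Commute ν (lamp p) := by
  induction h using Subgroup.closure_induction with
  | mem x hx => obtain ⟨q, _, rfl⟩ := hx; exact commute_lamp q p
  | one => exact Commute.one_left _
  | mul x y _ _ hx hy => exact hx.mul_left hy
  | inv x _ hx => exact hx.inv_left

/-- Since lamps commute and are involutions, a product of lamps from `insert p S` uses the lamp
at `p` at most once. -/
theorem mem_lampSubgroup_insert {S : Set (ℤ × ℤ)} {p : ℤ × ℤ} {ν : G}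
    (h : ν ∈ lampSubgroup (insert p S)) :
    ν ∈ lampSubgroup S ∨ ∃ μ ∈ lampSubgroup S, ν = μ * lamp p := by
  induction h using Subgroup.closure_induction with
  | mem x hx =>
    obtain ⟨q, rfl | hq, rfl⟩ := hx
    · exact .inr ⟨1, one_mem _, by simp⟩
    · exact .inl (lamp_mem hq)
  | one => exact .inl (one_mem _)
  | mul x y _ _ hx hy =>
    rcases hx with hx | ⟨μ, hμ, rfl⟩ <;> rcases hy with hy | ⟨κ, hκ, rfl⟩
    · exact .inl (mul_mem hx hy)
    · exact .inr ⟨x * κ, mul_mem hx hκ, by group⟩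
    · exact .inr ⟨μ * y, mul_mem hμ hy, by
        rw [mul_assoc, ← (commute_lamp_of_mem hy p).eq, mul_assoc]⟩
    · refine .inl ?_
      have : μ * lamp p * (κ * lamp p) = μ * κ := by
        rw [(commute_lamp_of_mem hκ p).eq, mul_assoc, ← mul_assoc (lamp p), lamp_mul_self, one_mul]
      rw [this]
      exact mul_mem hμ hκ
  | inv x _ hx =>
    rcases hx with hx | ⟨μ, hμ, rfl⟩
    · exact .inl (inv_mem hx)
    · refine .inr ⟨μ⁻¹, inv_mem hμ, ?_⟩
      rw [(commute_lamp_of_mem hμ p).eq, mul_inv_rev, inv_eq_of_mul_eq_one_left (lamp_mul_self p)]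

/-! ### Words in the generating set -/

/-- The words in the letters of `genSet` and their inverses. -/
def IsWord (w : List G) : Prop := ∀ x ∈ w, x ∈ genSet ∨ x⁻¹ ∈ genSet

theorem IsWord.append {v w : List G} (hv : IsWord v) (hw : IsWord w) : IsWord (v ++ w) := by
  intro x hx
  rcases List.mem_append.1 hx with h | h
  exacts [hv x h, hw x h]

theorem closure_genSet : Subgroup.closure genSet = ⊤ := by
  rw [eq_top_iff]
  intro g _
  refine PresentedGroup.generated_by relators _ (fun x => ?_) g
  apply Subgroup.subset_closure
  cases x
  exacts [.inl rfl, .inr (.inl rfl), .inr (.inr (.inl rfl))]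

theorem exists_word (g : G) :
    ∃ w : List G, IsWord w ∧ w.prod = g ∧ w.length = wordLength genSet g := by
  have hne : {k : ℕ | ∃ w : List G, (∀ x ∈ w, x ∈ genSet ∨ x⁻¹ ∈ genSet) ∧ w.prod = g ∧
      w.length = k}.Nonempty := by
    have hg : g ∈ (Subgroup.closure genSet).toSubmonoid := by simp [closure_genSet]
    rw [Subgroup.closure_toSubmonoid] at hg
    obtain ⟨w, hw, rfl⟩ := Submonoid.exists_list_of_mem_closure hg
    exact ⟨_, w, hw, rfl, rfl⟩
  exact Nat.sInf_mem hne

theorem wordLength_le {w : List G} (hw : IsWord w) : wordLength genSet w.prod ≤ w.length :=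
  Nat.sInf_le ⟨w, hw, rfl, rfl⟩

/-- Every letter toggles, moves by at most one step, and toggles again. -/
theorem exists_eq_of_letter {y : G} (hy : y ∈ genSet ∨ y⁻¹ ∈ genSet) :
    ∃ d : ℤ × ℤ, |d.1| + |d.2| ≤ 1 ∧ ∃ e e' : G, (e = 1 ∨ e = a) ∧ (e' = 1 ∨ e' = a) ∧
      y = e * shift d * e' := by
  have key : ∀ y ∈ genSet, ∃ d : ℤ × ℤ, |d.1| + |d.2| ≤ 1 ∧ ∃ e e' : G, (e = 1 ∨ e = a) ∧
      (e' = 1 ∨ e' = a) ∧ y = e * shift d * e' := by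
    intro y hy
    rcases hy with rfl | rfl | rfl | rfl | rfl | rfl | rfl | rfl | rfl
    · exact ⟨0, by simp, a, 1, by simp⟩
    · exact ⟨(1, 0), by simp, 1, 1, by simp [shift]⟩
    · exact ⟨(0, 1), by simp, 1, 1, by simp [shift]⟩
    · exact ⟨(0, 1), by simp, a, 1, by simp [shift]⟩
    · exact ⟨(0, 1), by simp, 1, a, by simp [shift]⟩
    · exact ⟨(0, 1), by simp, a, a, by simp [shift]⟩
    · exact ⟨(1, 0), by simp, a, 1, by simp [shift]⟩
    · exact ⟨(1, 0), by simp, 1, a, by simp [shift]⟩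
    · exact ⟨(1, 0), by simp, a, a, by simp [shift]⟩
  rcases hy with hy | hy
  · exact key y hy
  · obtain ⟨d, hd, e, e', he, he', h⟩ := key _ hy
    have inv_eq : ∀ e : G, e = 1 ∨ e = a → e⁻¹ = e := by
      rintro e (rfl | rfl)
      exacts [inv_one, a_inv]
    refine ⟨-d, by simpa using hd, e', e, he', he, ?_⟩
    rw [← inv_inv y, h, mul_inv_rev, mul_inv_rev, inv_eq e he, inv_eq e' he', shift_neg, mul_assoc]

/-- The four unit steps of the grid `ℤ × ℤ`. -/
def IsStep (d : ℤ × ℤ) : Prop := d = (1, 0) ∨ d = (-1, 0) ∨ d = (0, 1) ∨ d = (0, -1)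

theorem letter_of_isStep {d : ℤ × ℤ} (hd : IsStep d) {e : G} (he : e = 1 ∨ e = a) :
    shift d * e ∈ genSet ∨ (shift d * e)⁻¹ ∈ genSet := by
  rcases hd with rfl | rfl | rfl | rfl <;> rcases he with rfl | rfl <;>
    simp [shift, genSet, a_inv]

/-! ### Walks that light lamps -/

/-- Some walk of length `k` from the origin to `p` can light every configuration of lamps in `S`:
each `ν * shift p` with `ν ∈ lampSubgroup S` is the product of a word of length `k`. -/
def Covers (k : ℕ) (p : ℤ × ℤ) (S : Set (ℤ × ℤ)) : Prop :=
  ∀ ν ∈ lampSubgroup S, ∃ w : List G, IsWord w ∧ w.prod = ν * shift p ∧ w.length = k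

theorem Covers.mono {k : ℕ} {p : ℤ × ℤ} {S T : Set (ℤ × ℤ)} (h : Covers k p T) (hST : S ⊆ T) :
    Covers k p S := fun ν hν => h ν (lampSubgroup_mono hST hν)

theorem covers_zero : Covers 0 0 ∅ := by
  intro ν hν
  have : ν = 1 := by simpa [lampSubgroup] using hν
  exact ⟨[], by simp [IsWord], by simp [this], rfl⟩

theorem Covers.step {k : ℕ} {p d : ℤ × ℤ} {S : Set (ℤ × ℤ)} (h : Covers k p S) (hd : IsStep d) :
    Covers (k + 1) (p + d) (insert (p + d) S) := by
  intro ν hν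
  -- the last letter is `shift d`, followed by `a` if the lamp at `p + d` is to be toggled
  have key : ∀ μ ∈ lampSubgroup S, ∀ e : G, (e = 1 ∨ e = a) → ν * shift (p + d) =
      μ * shift (p + d) * e → ∃ w : List G, IsWord w ∧ w.prod = ν * shift (p + d) ∧
        w.length = k + 1 := by
    intro μ hμ e he hν
    obtain ⟨w, hw, hprod, hlen⟩ := h μ hμ
    refine ⟨w ++ [shift d * e], hw.append ?_, ?_, by simp [hlen]⟩
    · intro x hx
      rw [List.mem_singleton.1 hx]
      exact letter_of_isStep hd he
    · rw [List.prod_append, List.prod_singleton, hprod, hν, shift_add]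
      group
  rcases mem_lampSubgroup_insert hν with hν | ⟨μ, hμ, rfl⟩
  · exact key ν hν 1 (.inl rfl) (by simp)
  · exact key μ hμ a (.inr rfl) (by rw [mul_assoc, mul_assoc, shift_mul_a])

/-- Walking `m` steps in direction `d`. -/
theorem Covers.run {k : ℕ} {p d : ℤ × ℤ} {S : Set (ℤ × ℤ)} (h : Covers k p S) (hd : IsStep d)
    (m : ℕ) : Covers (k + m) (p + m • d) (S ∪ {q | ∃ l : ℕ, 1 ≤ l ∧ l ≤ m ∧ q = p + l • d}) := by
  induction m with
  | zero =>
    simp only [add_zero, zero_smul]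
    refine h.mono ?_
    rintro q (hq | ⟨l, h1, h2, _⟩)
    · exact hq
    · omega
  | succ m ih =>
    have := ih.step hd
    rw [add_assoc, add_assoc, ← succ_nsmul] at this
    refine this.mono ?_
    rintro q (hq | ⟨l, h1, h2, hq⟩)
    · exact .inr (.inl hq)
    · rcases Nat.le_succ_iff.1 h2 with h2 | rfl
      · exact .inr (.inr ⟨l, h1, h2, hq⟩)
      · exact .inl hq

theorem add_nsmul_mk (i j x y : ℤ) (m : ℕ) :
    ((i, j) : ℤ × ℤ) + m • (x, y) = (i + m * x, j + m * y) := by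
  simp

/-- Walking along a row from `(i, j)` to `(i', j)`. The lamp at the starting point is not among those
gained. -/
theorem Covers.horizontal {k : ℕ} {i j : ℤ} {S : Set (ℤ × ℤ)} (h : Covers k (i, j) S) (i' : ℤ) :
    Covers (k + (i' - i).natAbs) (i', j)
      (S ∪ {q | q.2 = j ∧ q.1 ≠ i ∧ (i ≤ q.1 ∧ q.1 ≤ i' ∨ i' ≤ q.1 ∧ q.1 ≤ i)}) := by
  rcases le_total i i' with hi | hi
  · have := h.run (d := (1, 0)) (.inl rfl) (i' - i).natAbs
    rw [show ((i, j) : ℤ × ℤ) + (i' - i).natAbs • (1, 0) = (i', j) by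
      rw [add_nsmul_mk, Prod.mk.injEq]; omega] at this
    refine this.mono (Set.union_subset_union_right _ ?_)
    rintro ⟨x, y⟩ ⟨h1, h2, h3⟩
    dsimp only at h1 h2 h3
    exact ⟨(x - i).natAbs, by omega, by omega, by
      rw [add_nsmul_mk, Prod.mk.injEq]; omega⟩
  · have := h.run (d := (-1, 0)) (.inr (.inl rfl)) (i' - i).natAbs
    rw [show ((i, j) : ℤ × ℤ) + (i' - i).natAbs • (-1, 0) = (i', j) by
      rw [add_nsmul_mk, Prod.mk.injEq]; omega] at this
    refine this.mono (Set.union_subset_union_right _ ?_)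
    rintro ⟨x, y⟩ ⟨h1, h2, h3⟩
    dsimp only at h1 h2 h3
    exact ⟨(x - i).natAbs, by omega, by omega, by
      rw [add_nsmul_mk, Prod.mk.injEq]; omega⟩

/-- Walking along a column from `(i, j)` to `(i, j')`. -/
theorem Covers.vertical {k : ℕ} {i j : ℤ} {S : Set (ℤ × ℤ)} (h : Covers k (i, j) S) (j' : ℤ) :
    Covers (k + (j' - j).natAbs) (i, j')
      (S ∪ {q | q.1 = i ∧ q.2 ≠ j ∧ (j ≤ q.2 ∧ q.2 ≤ j' ∨ j' ≤ q.2 ∧ q.2 ≤ j)}) := by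
  rcases le_total j j' with hj | hj
  · have := h.run (d := (0, 1)) (.inr (.inr (.inl rfl))) (j' - j).natAbs
    rw [show ((i, j) : ℤ × ℤ) + (j' - j).natAbs • (0, 1) = (i, j') by
      rw [add_nsmul_mk, Prod.mk.injEq]; omega] at this
    refine this.mono (Set.union_subset_union_right _ ?_)
    rintro ⟨x, y⟩ ⟨h1, h2, h3⟩
    dsimp only at h1 h2 h3
    exact ⟨(y - j).natAbs, by omega, by omega, by
      rw [add_nsmul_mk, Prod.mk.injEq]; omega⟩
  · have := h.run (d := (0, -1)) (.inr (.inr (.inr rfl))) (j' - j).natAbs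
    rw [show ((i, j) : ℤ × ℤ) + (j' - j).natAbs • (0, -1) = (i, j') by
      rw [add_nsmul_mk, Prod.mk.injEq]; omega] at this
    refine this.mono (Set.union_subset_union_right _ ?_)
    rintro ⟨x, y⟩ ⟨h1, h2, h3⟩
    dsimp only at h1 h2 h3
    exact ⟨(y - j).natAbs, by omega, by omega, by
      rw [add_nsmul_mk, Prod.mk.injEq]; omega⟩

/-! ### The triangle and its tripods -/

/-- The triangle with vertices `(n, n)`, `(n, -2n)` and `(-2n, n)`. -/
def triangle (n : ℕ) : Set (ℤ × ℤ) := {q | q.1 ≤ n ∧ q.2 ≤ n ∧ -(n : ℤ) ≤ q.1 + q.2}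

/-- The tripod in `triangle n` with centre `(i, j)`: the whole column of the centre, and the part
of its row from the centre to the side `q.1 = n`. -/
def tripod (n : ℕ) (i j : ℤ) : Set (ℤ × ℤ) :=
  {q | q ∈ triangle n ∧ (q.1 = i ∨ q.2 = j ∧ i ≤ q.1)}

/-- The lamps of a tripod generate those of the triangle: by `lamp_left`, a subgroup that contains
two of the lamps at `(i, j)`, `(i, j - 1)`, `(i - 1, j)` contains the third, so one column after
another is filled, to the left and to the right of the centre. -/
theorem lampSubgroup_tripod (n : ℕ) {i j : ℤ} (hi : i ≤ n) (hj : j ≤ n) (hij : -(n : ℤ) ≤ i + j) :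
    lampSubgroup (triangle n) ≤ lampSubgroup (tripod n i j) := by
  set K := lampSubgroup (tripod n i j)
  have col : ∀ y : ℤ, y ≤ n → -(n : ℤ) ≤ i + y → lamp (i, y) ∈ K := fun y h1 h2 =>
    lamp_mem ⟨⟨hi, h1, h2⟩, .inl rfl⟩
  have row : ∀ x : ℤ, i ≤ x → x ≤ n → lamp (x, j) ∈ K := fun x h1 h2 =>
    lamp_mem ⟨⟨h2, hj, by dsimp only; omega⟩, .inr ⟨rfl, h1⟩⟩
  have left : ∀ m : ℕ, ∀ y : ℤ, y ≤ n → -(n : ℤ) ≤ i - m + y → lamp (i - m, y) ∈ K := by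
    intro m
    induction m with
    | zero => intro y h1 h2; simpa using col y h1 (by simpa using h2)
    | succ m ih =>
      intro y h1 h2
      push_cast at h2 ⊢
      rw [← sub_sub, lamp_left]
      exact mul_mem (ih y h1 (by omega)) (ih (y - 1) (by omega) (by omega))
  have right : ∀ m : ℕ, i + m ≤ n → ∀ y : ℤ, y ≤ n → -(n : ℤ) ≤ i + m + y →
      lamp (i + m, y) ∈ K := by
    intro m
    induction m with
    | zero => intro _ y h1 h2; simpa using col y h1 (by simpa using h2)
    | succ m ih =>
      intro hm
      push_cast at hm ⊢
      have base : lamp (i + (m + 1), j) ∈ K := row _ (by omega) hm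
      have prev : ∀ y : ℤ, y ≤ n → -(n : ℤ) ≤ i + m + y →
          lamp (i + (m + 1), y) * lamp (i + (m + 1), y - 1) ∈ K := by
        intro y h1 h2
        rw [← lamp_left, show i + ((m : ℤ) + 1) - 1 = i + m by ring]
        exact ih (by omega) y h1 h2
      have up : ∀ l : ℕ, j + l ≤ n → lamp (i + (m + 1), j + l) ∈ K := by
        intro l
        induction l with
        | zero => intro _; simpa using base
        | succ l ihl =>
          intro hl
          push_cast at hl ⊢
          have h := prev (j + (l + 1)) hl (by omega)
          rw [show j + ((l : ℤ) + 1) - 1 = j + l by ring] at h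
          exact (Subgroup.mul_mem_cancel_right K (ihl (by omega))).1 h
      have down : ∀ l : ℕ, -(n : ℤ) ≤ i + (m + 1) + (j - l) →
          lamp (i + (m + 1), j - l) ∈ K := by
        intro l
        induction l with
        | zero => intro _; simpa using base
        | succ l ihl =>
          intro hl
          push_cast at hl ⊢
          have h := prev (j - l) (by omega) (by omega)
          rw [show j - (l : ℤ) - 1 = j - (l + 1) by ring] at h
          exact (Subgroup.mul_mem_cancel_left K (ihl (by omega))).1 h
      intro y h1 h2
      rcases le_total j y with h | h
      · have := up (y - j).natAbs (by omega)
        rwa [show j + ((y - j).natAbs : ℤ) = y by omega] at this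
      · have := down (y - j).natAbs (by omega)
        rwa [show j - ((y - j).natAbs : ℤ) = y by omega] at this
  refine (Subgroup.closure_le _).2 ?_
  rintro _ ⟨⟨x, y⟩, ⟨h1, h2, h3⟩, rfl⟩
  dsimp only at h1 h2 h3
  rcases le_total i x with h | h
  · have := right (x - i).natAbs (by omega) y h2 (by omega)
    rwa [show i + ((x - i).natAbs : ℤ) = x by omega] at this
  · have := left (x - i).natAbs y h2 (by omega)
    rwa [show i - ((x - i).natAbs : ℤ) = x by omega] at this

/-- Near the origin, every configuration of lamps in the triangle is reached within `6 n` steps.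
The walk goes around a tripod that contains both the origin and the final position `p`; it traverses
each edge twice, except those between the origin and `p`. -/
theorem wordLength_le_of_mem_triangle {n : ℕ} (hn : 1 ≤ n) {ν : G}
    (hν : ν ∈ lampSubgroup (triangle n)) {p : ℤ × ℤ} (hp : |p.1| + |p.2| ≤ n) :
    wordLength genSet (ν * shift p) ≤ 6 * n := by
  obtain ⟨i, j⟩ := p
  dsimp only at hp
  have h1 := abs_le.1 (le_trans (le_add_of_nonneg_right (abs_nonneg j)) hp)
  have h2 := abs_le.1 (le_trans (le_add_of_nonneg_left (abs_nonneg i)) hp)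
  suffices h : ∃ c : ℤ × ℤ, ∃ k, c.1 ≤ n ∧ c.2 ≤ n ∧ -(n : ℤ) ≤ c.1 + c.2 ∧ k ≤ 6 * n ∧
      Covers k (i, j) (tripod n c.1 c.2) by
    obtain ⟨c, k, hc1, hc2, hc3, hk, h⟩ := h
    obtain ⟨w, hw, hprod, hlen⟩ := h ν (lampSubgroup_tripod n hc1 hc2 hc3 hν)
    rw [← hprod]
    exact (wordLength_le hw).trans (hlen.trans_le hk)
  -- the lamp at the origin is not toggled before the walk first returns there
  have h0 : Covers 0 (0, 0) ∅ := covers_zero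
  rcases le_total i 0 with hi | hi
  · -- the centre is `(i, 0)`: walk the row first, then the column, starting with the end
    -- on the far side of the row from `p`
    have hrow := (h0.horizontal n).horizontal i
    refine ⟨(i, 0), ?_⟩
    rcases le_total j 0 with hj | hj
    · refine ⟨_, by dsimp only; omega, by dsimp only; omega, by dsimp only; omega, ?_,
        (((hrow.vertical n).vertical (-n - i)).vertical j).mono ?_⟩
      · omega
      · rintro ⟨x, y⟩ ⟨⟨h4, h5, h6⟩, h7⟩
        simp only [Set.mem_union, Set.mem_ofPred_eq, Set.mem_empty_iff_false] at *
        omega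
    · refine ⟨_, by dsimp only; omega, by dsimp only; omega, by dsimp only; omega, ?_,
        (((hrow.vertical (-n - i)).vertical n).vertical j).mono ?_⟩
      · omega
      · rintro ⟨x, y⟩ ⟨⟨h4, h5, h6⟩, h7⟩
        simp only [Set.mem_union, Set.mem_ofPred_eq, Set.mem_empty_iff_false] at *
        omega
  · -- the centre is `(0, j)`: walk the column first, then the row
    refine ⟨(0, j), ?_⟩
    rcases le_total j 0 with hj | hj
    · refine ⟨_, by dsimp only; omega, by dsimp only; omega, by dsimp only; omega, ?_,
        (((((h0.vertical n).vertical (-n)).vertical j).horizontal n).horizontal i).mono ?_⟩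
      · omega
      · rintro ⟨x, y⟩ ⟨⟨h4, h5, h6⟩, h7⟩
        simp only [Set.mem_union, Set.mem_ofPred_eq, Set.mem_empty_iff_false] at *
        omega
    · refine ⟨_, by dsimp only; omega, by dsimp only; omega, by dsimp only; omega, ?_,
        (((((h0.vertical (-n)).vertical n).vertical j).horizontal n).horizontal i).mono ?_⟩
      · omega
      · rintro ⟨x, y⟩ ⟨⟨h4, h5, h6⟩, h7⟩
        simp only [Set.mem_union, Set.mem_ofPred_eq, Set.mem_empty_iff_false] at *
        omega

/-! ### Neighbours of the dead ends -/

/-- A short word moves a short way and lights lamps near the origin only. -/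
theorem exists_eq_of_isWord {w : List G} (hw : IsWord w) :
    ∃ p : ℤ × ℤ, |p.1| + |p.2| ≤ w.length ∧
      ∃ ν ∈ lampSubgroup {q | |q.1| + |q.2| ≤ w.length}, w.prod = ν * shift p := by
  induction w using List.reverseRecOn with
  | nil => exact ⟨0, by simp, 1, one_mem _, by simp⟩
  | append_singleton w y ih =>
    obtain ⟨p, hp, ν, hν, hprod⟩ := ih fun x hx => hw x (by simp [hx])
    obtain ⟨d, hd, e, e', he, he', rfl⟩ := exists_eq_of_letter (hw y (by simp))
    have hlen : ((w ++ [e * shift d * e']).length : ℤ) = w.length + 1 := by simp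
    rw [hlen]
    have hpd : |(p + d).1| + |(p + d).2| ≤ (w.length : ℤ) + 1 := by
      have h1 := abs_add_le p.1 d.1
      have h2 := abs_add_le p.2 d.2
      simp only [Prod.fst_add, Prod.snd_add]
      omega
    have toggle : ∀ (q : ℤ × ℤ) (e : G), |q.1| + |q.2| ≤ (w.length : ℤ) + 1 → e = 1 ∨ e = a →
        ∃ κ ∈ lampSubgroup {q | |q.1| + |q.2| ≤ (w.length : ℤ) + 1},
          shift q * e = κ * shift q := by
      rintro q e hq (rfl | rfl)
      · exact ⟨1, one_mem _, by simp⟩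
      · exact ⟨lamp q, lamp_mem hq, shift_mul_a q⟩
    obtain ⟨κ, hκ, h1⟩ := toggle p e (by omega) he
    obtain ⟨κ', hκ', h2⟩ := toggle (p + d) e' hpd he'
    have hν' : ν ∈ lampSubgroup {q | |q.1| + |q.2| ≤ (w.length : ℤ) + 1} :=
      lampSubgroup_mono (fun q hq => by
        simp only [Set.mem_ofPred_eq] at hq ⊢; omega) hν
    refine ⟨p + d, hpd, ν * κ * κ', mul_mem (mul_mem hν' hκ) hκ', ?_⟩
    calc (w ++ [e * shift d * e']).prod = ν * (shift p * e) * shift d * e' := by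
          rw [List.prod_append, List.prod_singleton, hprod]; group
      _ = ν * κ * (shift (p + d) * e') := by rw [h1, shift_add]; group
      _ = ν * κ * κ' * shift (p + d) := by rw [h2]; group

theorem gElt_eq (n : ℕ) : gElt n = lamp (n, 0) * lamp (0, n) * lamp (0, -n) := by
  simp only [gElt, lamp, shift, zpow_natCast, zpow_zero, zpow_neg, one_mul, mul_one, two_mul,
    pow_add]
  group

theorem wordLength_gElt_mul_le {n : ℕ} {w : List G} (hw : IsWord w) (hn : 1 ≤ n)
    (hwn : w.length ≤ n) :
    wordLength genSet (gElt n * w.prod) ≤ 6 * n := by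
  obtain ⟨p, hp, ν, hν, h⟩ := exists_eq_of_isWord hw
  rw [h, gElt_eq, ← mul_assoc]
  refine wordLength_le_of_mem_triangle hn (mul_mem (mul_mem (mul_mem ?_ ?_) ?_) ?_) (by omega)
  · exact lamp_mem (by simp only [triangle, Set.mem_ofPred_eq]; omega)
  · exact lamp_mem (by simp only [triangle, Set.mem_ofPred_eq]; omega)
  · exact lamp_mem (by simp only [triangle, Set.mem_ofPred_eq]; omega)
  · refine lampSubgroup_mono (fun q hq => ?_) hν
    simp only [triangle, Set.mem_ofPred_eq] at hq ⊢
    have := neg_abs_le q.1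
    have := neg_abs_le q.2
    have := le_abs_self q.1
    have := le_abs_self q.2
    have := abs_nonneg q.1
    have := abs_nonneg q.2
    omega

/-! ### Representations over a field of characteristic two -/

/-- The lamplighter group with lamps in a field: a pair of a position and an element of `F`, where
the position `(i, j)` acts on `F` as multiplication by `u ^ i * v ^ j`. -/
@[ext]
structure FieldLamplighter {F : Type*} [Field F] (u v : Fˣ) where
  /-- The position. -/
  pos : ℤ × ℤ
  /-- The sum of the field elements `u ^ i * v ^ j` over the positions `(i, j)` of the lit lamps. -/
  lamps : F

namespace FieldLamplighter

variable {F : Type*} [Field F] {u v : Fˣ}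

/-- The unit by which the position `p` acts; it is also the contribution of a lamp at `p`. -/
def weight (u v : Fˣ) (p : ℤ × ℤ) : Fˣ := u ^ p.1 * v ^ p.2

theorem weight_add (p q : ℤ × ℤ) : weight u v (p + q) = weight u v p * weight u v q := by
  simp only [weight, Prod.fst_add, Prod.snd_add, zpow_add, mul_mul_mul_comm]

@[simp] theorem weight_zero : weight u v 0 = 1 := by simp [weight]

instance : Mul (FieldLamplighter u v) :=
  ⟨fun g h => ⟨g.pos + h.pos, g.lamps + weight u v g.pos * h.lamps⟩⟩

instance : One (FieldLamplighter u v) := ⟨⟨0, 0⟩⟩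

instance : Inv (FieldLamplighter u v) :=
  ⟨fun g => ⟨-g.pos, -(weight u v (-g.pos) * g.lamps)⟩⟩

@[simp] theorem mul_pos (g h : FieldLamplighter u v) : (g * h).pos = g.pos + h.pos := rfl

@[simp] theorem mul_lamps (g h : FieldLamplighter u v) :
    (g * h).lamps = g.lamps + weight u v g.pos * h.lamps := rfl

@[simp] theorem one_pos : (1 : FieldLamplighter u v).pos = 0 := rfl

@[simp] theorem one_lamps : (1 : FieldLamplighter u v).lamps = 0 := rfl

@[simp] theorem inv_pos (g : FieldLamplighter u v) : g⁻¹.pos = -g.pos := rfl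

@[simp] theorem inv_lamps (g : FieldLamplighter u v) :
    g⁻¹.lamps = -(weight u v (-g.pos) * g.lamps) := rfl

instance : Group (FieldLamplighter u v) :=
  Group.ofLeftAxioms
    (fun g h k => by
      ext
      · simp [add_assoc]
      · simp [add_assoc]
      · simp only [mul_lamps, mul_pos, weight_add, Units.val_mul]; ring)
    (fun g => by ext <;> simp)
    (fun g => by ext <;> simp)

/-- The images of the generators: `a` toggles the lamp at the origin, `s` and `t` move by
`(1, 0)` and `(0, 1)`. -/
def ofLetter (u v : Fˣ) : Letter → FieldLamplighter u v
  | .a => ⟨0, 1⟩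
  | .s => ⟨(1, 0), 0⟩
  | .t => ⟨(0, 1), 0⟩

theorem lift_ofLetter_eq_one [CharP F 2] (huv : ((u⁻¹ : Fˣ) : F) = 1 + ((v⁻¹ : Fˣ) : F))
    (r : FreeGroup Letter) (hr : r ∈ relators) : FreeGroup.lift (ofLetter u v) r = 1 := by
  have h2 : (1 : F) + 1 = 0 := CharTwo.add_self_eq_zero 1
  rcases hr with rfl | rfl | rfl | rfl
  · ext <;> simp [ofLetter, pow_two, h2]
  · ext
    · simp [ofLetter, comm, conjBy]
    · simp [ofLetter, comm, conjBy]
    · simp [ofLetter, comm, conjBy, weight]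
  · ext <;> simp [ofLetter, comm]
  · rw [map_mul, map_inv, mul_inv_eq_one]
    ext
    · simp [ofLetter, conjBy]
    · simp [ofLetter, conjBy]
    · simpa [ofLetter, conjBy, weight] using huv

/-- The representation of `G` for units `u`, `v` that satisfy `u⁻¹ = 1 + v⁻¹`. -/
def rep [CharP F 2] (huv : ((u⁻¹ : Fˣ) : F) = 1 + ((v⁻¹ : Fˣ) : F)) :
    G →* FieldLamplighter u v :=
  PresentedGroup.toGroup (lift_ofLetter_eq_one huv)

/-- The position as a homomorphism. -/
def posHom (u v : Fˣ) : FieldLamplighter u v →* Multiplicative (ℤ × ℤ) where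
  toFun g := .ofAdd g.pos
  map_one' := rfl
  map_mul' _ _ := rfl

theorem zpow_lamps_eq_zero {g : FieldLamplighter u v} (h : g.lamps = 0) (k : ℤ) :
    (g ^ k).lamps = 0 := by
  let S : Subgroup (FieldLamplighter u v) :=
    { carrier := {g | g.lamps = 0}
      one_mem' := rfl
      mul_mem' := by
        intro x y hx hy
        simp only [Set.mem_ofPred_eq] at hx hy ⊢
        simp [hx, hy]
      inv_mem' := by
        intro x hx
        simp only [Set.mem_ofPred_eq] at hx ⊢
        simp [hx] }
  exact S.zpow_mem h k

open WithZero in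
theorem valuation_weight (val : Valuation F ℤᵐ⁰) {α β : ℤ} (hu : val u = exp α)
    (hv : val v = exp β) (p : ℤ × ℤ) : val (weight u v p : F) = exp (α * p.1 + β * p.2) := by
  rw [weight, Units.val_mul, Units.val_zpow_eq_zpow_val, Units.val_zpow_eq_zpow_val, map_mul,
    map_zpow₀, map_zpow₀, hu, hv, exp_add, mul_comm α, mul_comm β, ← smul_eq_mul p.1 α,
    ← smul_eq_mul p.2 β, exp_zsmul, exp_zsmul]

end FieldLamplighter

/-- The homomorphism that sends an element of `G` to its position. -/
def position : G →* Multiplicative (ℤ × ℤ) :=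
  PresentedGroup.toGroup (f := fun x => match x with
    | .a => 1
    | .s => .ofAdd (1, 0)
    | .t => .ofAdd (0, 1)) (by
      intro r hr
      rcases hr with rfl | rfl | rfl | rfl
      · simp
      · simp [comm, conjBy]
      · simp [comm]
      · simp [conjBy])

/-- The position of an element of `G`, as a pair of integers. -/
def coords (g : G) : ℤ × ℤ := (position g).toAdd

@[simp] theorem coords_mul (g h : G) : coords (g * h) = coords g + coords h := by simp [coords]

@[simp] theorem coords_one : coords 1 = 0 := by simp [coords]

@[simp] theorem coords_inv (g : G) : coords g⁻¹ = -coords g := by simp [coords]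

@[simp] theorem coords_a : coords a = 0 := by simp [coords, position, a]

@[simp] theorem coords_s : coords s = (1, 0) := by simp [coords, position, s]

@[simp] theorem coords_t : coords t = (0, 1) := by simp [coords, position, t]

@[simp] theorem coords_zpow (g : G) (k : ℤ) : coords (g ^ k) = k • coords g := by simp [coords]

@[simp] theorem coords_shift (p : ℤ × ℤ) : coords (shift p) = p := by
  ext <;> simp [shift]

@[simp] theorem coords_lamp (p : ℤ × ℤ) : coords (lamp p) = 0 := by simp [lamp]

namespace FieldLamplighter

variable {F : Type*} [Field F] {u v : Fˣ} [CharP F 2]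
  (huv : ((u⁻¹ : Fˣ) : F) = 1 + ((v⁻¹ : Fˣ) : F))

@[simp] theorem rep_a : rep huv a = ⟨0, 1⟩ := PresentedGroup.toGroup.of _

@[simp] theorem rep_s : rep huv s = ⟨(1, 0), 0⟩ := PresentedGroup.toGroup.of _

@[simp] theorem rep_t : rep huv t = ⟨(0, 1), 0⟩ := PresentedGroup.toGroup.of _

@[simp] theorem pos_rep (g : G) : (rep huv g).pos = coords g := by
  have : (posHom u v).comp (rep huv) = position := by
    refine PresentedGroup.ext fun x => ?_
    cases x
    · exact congrArg (posHom u v) (rep_a huv)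
    · exact congrArg (posHom u v) (rep_s huv)
    · exact congrArg (posHom u v) (rep_t huv)
  exact congrArg Multiplicative.toAdd (DFunLike.congr_fun this g)

@[simp] theorem lamps_rep_shift (p : ℤ × ℤ) : (rep huv (shift p)).lamps = 0 := by
  simp [shift, zpow_lamps_eq_zero]

@[simp] theorem lamps_rep_lamp (p : ℤ × ℤ) : (rep huv (lamp p)).lamps = weight u v p := by
  simp [lamp]

/-! ### Valuations and the positions a word visits -/

open WithZero

/-- If a word visits only positions `(i, j)` with `α * i + β * j < n`, then all lamps that it
toggles have valuation less than `exp n`, and hence so has the sum of its lit lamps. -/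
theorem valuation_lamps_lt (val : Valuation F ℤᵐ⁰) {α β n : ℤ} (hu : val u = exp α)
    (hv : val v = exp β) {w : List G} (hw : IsWord w)
    (hpre : ∀ l, l <+: w → α * (coords l.prod).1 + β * (coords l.prod).2 < n) :
    val (rep huv w.prod).lamps < exp n := by
  have hval := valuation_weight val hu hv
  induction w using List.reverseRecOn with
  | nil => simp
  | append_singleton w y ih =>
    have ih := ih (fun x hx => hw x (by simp [hx]))
      (fun l hl => hpre l (hl.trans (List.prefix_append _ _)))
    have h1 := hpre w (List.prefix_append _ _)
    have h2 := hpre (w ++ [y]) List.prefix_rfl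
    obtain ⟨d, -, e, e', he, he', rfl⟩ := exists_eq_of_letter (hw y (by simp))
    have toggle : ∀ e : G, e = 1 ∨ e = a →
        coords e = 0 ∧ ((rep huv e).lamps = 0 ∨ (rep huv e).lamps = 1) := by
      rintro e (rfl | rfl) <;> simp
    obtain ⟨hpe, he⟩ := toggle e he
    obtain ⟨hpe', he'⟩ := toggle e' he'
    have h2' : α * (coords w.prod + d).1 + β * (coords w.prod + d).2 < n := by
      simpa [hpe, hpe'] using h2
    have key : (rep huv (w ++ [e * shift d * e']).prod).lamps = (rep huv w.prod).lamps +
        weight u v (coords w.prod) * (rep huv e).lamps +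
        weight u v (coords w.prod + d) * (rep huv e').lamps := by
      simp [hpe, weight_add]
      ring
    rw [key]
    refine val.map_add_lt (val.map_add_lt ih ?_) ?_
    · rcases he with he | he <;> simp only [he, mul_zero, mul_one, map_zero, hval]
      exacts [exp_pos, exp_lt_exp.2 h1]
    · rcases he' with he | he <;> simp only [he, mul_zero, mul_one, map_zero, hval]
      exacts [exp_pos, exp_lt_exp.2 h2']

/-- The lamps of `gElt n` are at the points `n • q` for `q = (1, 0), (0, 1), (0, -1)`. If the
linear form `α * i + β * j` is `1` at just one of these points, and less at the others, then every
word for `gElt n` visits a position where the form is at least `n`. -/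
theorem exists_prefix (huv : ((u⁻¹ : Fˣ) : F) = 1 + ((v⁻¹ : Fˣ) : F))
    (val : Valuation F ℤᵐ⁰) {α β : ℤ} (hu : val u = exp α) (hv : val v = exp β)
    (hαβ : α = 1 ∧ β = 0 ∨ α = 0 ∧ β = 1 ∨ α = -1 ∧ β = -1)
    {n : ℕ} (hn : 1 ≤ n) {w : List G} (hw : IsWord w) (hprod : w.prod = gElt n) :
    ∃ l, l <+: w ∧ n ≤ α * (coords l.prod).1 + β * (coords l.prod).2 := by
  by_contra! hcon
  have hlt := valuation_lamps_lt huv val hu hv hw hcon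
  have hval := valuation_weight val hu hv
  have hsum : (rep huv (gElt n)).lamps =
      weight u v (n, 0) + weight u v (0, n) + weight u v (0, -n) := by
    rw [gElt_eq]
    simp
  rw [hprod, hsum] at hlt
  have hA := hval (n, 0)
  have hB := hval (0, n)
  have hC := hval (0, -n)
  set A : F := ((weight u v (n, 0) : Fˣ) : F)
  set B : F := ((weight u v (0, n) : Fˣ) : F)
  set C : F := ((weight u v (0, -n) : Fˣ) : F)
  simp only [mul_zero, add_zero, zero_add, mul_neg] at hA hB hC
  rcases hαβ with ⟨rfl, rfl⟩ | ⟨rfl, rfl⟩ | ⟨rfl, rfl⟩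
  · have h : val A < exp (n : ℤ) := by
      rw [show A = A + B + C - (B + C) by ring]
      refine val.map_sub_lt hlt (val.map_add_lt ?_ ?_)
      · rw [hB, exp_lt_exp]; omega
      · rw [hC, exp_lt_exp]; omega
    rw [hA, exp_lt_exp] at h
    omega
  · have h : val B < exp (n : ℤ) := by
      rw [show B = A + B + C - (A + C) by ring]
      refine val.map_sub_lt hlt (val.map_add_lt ?_ ?_)
      · rw [hA, exp_lt_exp]; omega
      · rw [hC, exp_lt_exp]; omega
    rw [hB, exp_lt_exp] at h
    omega
  · have h : val C < exp (n : ℤ) := by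
      rw [show C = A + B + C - (A + B) by ring]
      refine val.map_sub_lt hlt (val.map_add_lt ?_ ?_)
      · rw [hA, exp_lt_exp]; omega
      · rw [hB, exp_lt_exp]; omega
    rw [hC, exp_lt_exp] at h
    omega

end FieldLamplighter

open Classical WithZero FieldLamplighter in
/-- Every word for `gElt n` visits the three sides of `triangle n`. The three sides correspond to
the places `x = 1`, `0`, `∞` of the function field `𝔽₂(x)`, where `x = v⁻¹` and `1 + x = u⁻¹`; each
becomes the place at infinity of `𝔽₂(X)` on setting `x` to `1 + 1 / X`, `1 / X` and `X`. -/
theorem exists_prefixes {n : ℕ} (hn : 1 ≤ n) {w : List G} (hw : IsWord w)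
    (hprod : w.prod = gElt n) :
    (∃ l, l <+: w ∧ n ≤ (coords l.prod).1) ∧ (∃ l, l <+: w ∧ n ≤ (coords l.prod).2) ∧
      (∃ l, l <+: w ∧ n ≤ -(coords l.prod).1 - (coords l.prod).2) := by
  have main : ∀ (x y : RatFunc (ZMod 2)), y = 1 + x → ∀ α β : ℤ,
      (α = 1 ∧ β = 0 ∨ α = 0 ∧ β = 1 ∨ α = -1 ∧ β = -1) →
      RatFunc.inftyValuation (ZMod 2) y = exp (-α) →
      RatFunc.inftyValuation (ZMod 2) x = exp (-β) →
      ∃ l, l <+: w ∧ n ≤ α * (coords l.prod).1 + β * (coords l.prod).2 := by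
    intro x y hxy α β hαβ hy hx
    have hx0 : x ≠ 0 := by rintro rfl; exact exp_ne_zero (hx.symm.trans (map_zero _))
    have hy0 : y ≠ 0 := by rintro rfl; exact exp_ne_zero (hy.symm.trans (map_zero _))
    have : CharP (RatFunc (ZMod 2)) 2 := charP_of_injective_algebraMap
      (algebraMap (ZMod 2) (RatFunc (ZMod 2))).injective 2
    refine exists_prefix (u := (Units.mk0 y hy0)⁻¹) (v := (Units.mk0 x hx0)⁻¹) (by simpa using hxy)
      (RatFunc.inftyValuation (ZMod 2)) ?_ ?_ hαβ hn hw hprod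
    · simp [hy]
    · simp [hx]
  have h2 : (1 : RatFunc (ZMod 2)) + 1 = 0 := by
    have : (1 : ZMod 2) + 1 = 0 := by decide
    simpa using congrArg (algebraMap (ZMod 2) (RatFunc (ZMod 2))) this
  have hX : RatFunc.inftyValuation (ZMod 2) RatFunc.X = exp 1 := RatFunc.inftyValuation.X _
  have hXinv : RatFunc.inftyValuation (ZMod 2) RatFunc.X⁻¹ = exp (-1) := by
    rw [map_inv₀, hX, exp_neg]
  have h1X : RatFunc.inftyValuation (ZMod 2) (1 + RatFunc.X) = exp 1 := by
    rw [Valuation.map_add_eq_of_lt_right, hX]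
    rw [map_one, hX, ← exp_zero, exp_lt_exp]
    omega
  have h1Xinv : RatFunc.inftyValuation (ZMod 2) (1 + RatFunc.X⁻¹) = exp 0 := by
    rw [Valuation.map_add_eq_of_lt_left, map_one, exp_zero]
    rw [map_one, hXinv, ← exp_zero, exp_lt_exp]
    omega
  refine ⟨?_, ?_, ?_⟩
  · obtain ⟨l, hl, h⟩ := main (1 + RatFunc.X⁻¹) RatFunc.X⁻¹ (by rw [← add_assoc, h2, zero_add])
      1 0 (by simp) hXinv (by simpa using h1Xinv)
    exact ⟨l, hl, by omega⟩
  · obtain ⟨l, hl, h⟩ := main RatFunc.X⁻¹ (1 + RatFunc.X⁻¹) rfl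
      0 1 (by simp) (by simpa using h1Xinv) hXinv
    exact ⟨l, hl, by omega⟩
  · obtain ⟨l, hl, h⟩ := main RatFunc.X (1 + RatFunc.X) rfl
      (-1) (-1) (by simp) h1X (by rwa [neg_neg])
    exact ⟨l, hl, by omega⟩

/-! ### Closed walks -/

theorem sum_le_sum_abs (l : List ℤ) : |l.sum| ≤ (l.map (|·|)).sum := by
  induction l with
  | nil => simp
  | cons x l ih =>
    simp only [List.sum_cons, List.map_cons]
    exact (abs_add_le _ _).trans (by omega)

/-- A closed walk on the integers traverses twice the interval between two points it visits. -/
theorem two_mul_sub_le_sum_abs {l p q : List ℤ} (hl : l.sum = 0) (hp : p <+: l) (hq : q <+: l) :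
    2 * (p.sum - q.sum) ≤ (l.map (|·|)).sum := by
  rcases List.prefix_or_prefix_of_prefix hp hq with ⟨m, rfl⟩ | ⟨m, rfl⟩
  · obtain ⟨r, rfl⟩ := hq
    have h1 := abs_le.1 (sum_le_sum_abs p)
    have h2 := abs_le.1 (sum_le_sum_abs m)
    have h3 := abs_le.1 (sum_le_sum_abs r)
    simp only [List.sum_append, List.map_append] at *
    omega
  · obtain ⟨r, rfl⟩ := hp
    have h1 := abs_le.1 (sum_le_sum_abs q)
    have h2 := abs_le.1 (sum_le_sum_abs m)
    have h3 := abs_le.1 (sum_le_sum_abs r)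
    simp only [List.sum_append, List.map_append] at *
    omega

theorem sum_map_coords_fst (w : List G) :
    (w.map fun g => (coords g).1).sum = (coords w.prod).1 := by
  induction w with
  | nil => simp
  | cons x w ih => simp [ih]

theorem sum_map_coords_snd (w : List G) :
    (w.map fun g => (coords g).2).sum = (coords w.prod).2 := by
  induction w with
  | nil => simp
  | cons x w ih => simp [ih]

/-- Every letter moves by at most one step. -/
theorem sum_abs_coords_le_length {w : List G} (hw : IsWord w) :
    ((w.map fun g => (coords g).1).map (|·|)).sum + ((w.map fun g => (coords g).2).map (|·|)).sum ≤
      w.length := by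
  induction w with
  | nil => simp
  | cons y w ih =>
    have ih := ih fun x hx => hw x (by simp [hx])
    obtain ⟨d, hd, e, e', he, he', rfl⟩ := exists_eq_of_letter (hw y (by simp))
    have toggle : ∀ e : G, e = 1 ∨ e = a → coords e = 0 := by
      rintro e (rfl | rfl) <;> simp
    simp only [List.map_cons, List.sum_cons, List.length_cons, coords_mul, toggle e he,
      toggle e' he', coords_shift, zero_add, add_zero]
    push_cast
    omega

/-- A word for `gElt n` is a closed walk that meets all three sides of `triangle n`; the horizontal
and vertical distances from the third side to the first two add up to at least `3 n`. -/
theorem six_mul_le_length {n : ℕ} (hn : 1 ≤ n) {w : List G} (hw : IsWord w)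
    (hprod : w.prod = gElt n) : 6 * n ≤ w.length := by
  obtain ⟨⟨p, hp, hpn⟩, ⟨q, hq, hqn⟩, r, hr, hrn⟩ := exists_prefixes hn hw hprod
  have hclosed : coords w.prod = 0 := by rw [hprod, gElt_eq]; simp
  have hx := two_mul_sub_le_sum_abs (by rw [sum_map_coords_fst, hclosed]; rfl)
    (hp.map fun g => (coords g).1) (hr.map fun g => (coords g).1)
  have hy := two_mul_sub_le_sum_abs (by rw [sum_map_coords_snd, hclosed]; rfl)
    (hq.map fun g => (coords g).2) (hr.map fun g => (coords g).2)
  have hlen := sum_abs_coords_le_length hw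
  simp only [sum_map_coords_fst, sum_map_coords_snd] at hx hy
  omega

/-! ### Length and depth -/

theorem le_wordLength_s_pow (m : ℕ) : m ≤ wordLength genSet (s ^ m) := by
  obtain ⟨w, hw, hprod, hlen⟩ := exists_word (s ^ m)
  have h1 := sum_abs_coords_le_length hw
  have h2 := (le_abs_self _).trans (sum_le_sum_abs (w.map fun g => (coords g).1))
  have h3 := (abs_nonneg _).trans (sum_le_sum_abs (w.map fun g => (coords g).2))
  rw [sum_map_coords_fst, hprod, ← zpow_natCast, coords_zpow, coords_s] at h2
  simp only [Prod.smul_mk, smul_eq_mul, mul_one] at h2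
  omega

theorem wordLength_gElt {n : ℕ} (hn : 1 ≤ n) : wordLength genSet (gElt n) = 6 * n := by
  refine le_antisymm ?_ ?_
  · simpa using wordLength_gElt_mul_le (w := []) (by simp [IsWord]) hn (by simp)
  · obtain ⟨w, hw, hprod, hlen⟩ := exists_word (gElt n)
    exact hlen ▸ six_mul_le_length hn hw hprod

theorem le_deadEndDepth_gElt {n : ℕ} (hn : 1 ≤ n) : n ≤ deadEndDepth genSet (gElt n) := by
  refine le_csInf ?_ ?_
  · -- `s ^ (6 * n + 1)` is longer than `gElt n`, so the depth is not a junk value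
    refine ⟨_, s ^ (6 * n + 1), ?_, rfl⟩
    simp only [wordDist, inv_one, one_mul, wordLength_gElt hn]
    exact le_wordLength_s_pow (6 * n + 1)
  · rintro _ ⟨h, hlt, rfl⟩
    simp only [wordDist, inv_one, one_mul, wordLength_gElt hn] at hlt ⊢
    by_contra! hcon
    obtain ⟨w, hw, hprod, hlen⟩ := exists_word ((gElt n)⁻¹ * h)
    have := wordLength_gElt_mul_le hw hn (by omega)
    rw [hprod, mul_inv_cancel_left] at this
    omega

theorem isFinitelyPresented_G : Group.IsFinitelyPresented G := by
  have : Finite Letter := .of_surjective (fun k : Fin 3 => ![Letter.a, Letter.s, Letter.t] k) (by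
    rintro (_ | _ | _)
    exacts [⟨0, rfl⟩, ⟨1, rfl⟩, ⟨2, rfl⟩])
  have : Finite relators := Set.Finite.to_subtype (by simp [relators])
  infer_instance

theorem infinite_G : Infinite G := by
  refine Infinite.of_injective (fun k : ℤ => s ^ k) fun k l h => ?_
  simpa using congrArg (fun g => (coords g).1) h

end DeadEnd

theorem theorem1 :
    -- `G` is a finitely presented infinite group and `genSet` is a finite generating set of it
    (Group.IsFinitelyPresented DeadEnd.G ∧ Infinite DeadEnd.G ∧
      DeadEnd.genSet.Finite ∧ Subgroup.closure DeadEnd.genSet = ⊤) ∧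
    -- the elements `g_n` have length `6n` and depth at least `n`
    (∀ n : ℕ, 1 ≤ n →
      DeadEnd.wordLength DeadEnd.genSet (DeadEnd.gElt n) = 6 * n ∧
      n ≤ DeadEnd.deadEndDepth DeadEnd.genSet (DeadEnd.gElt n)) ∧
    -- the dead-end depth of elements of `G` is unbounded
    (∀ N : ℕ, ∃ g : DeadEnd.G, N ≤ DeadEnd.deadEndDepth DeadEnd.genSet g) ∧
    -- so it is not true that dead-end depth is bounded for every infinite finitely presented
    -- group and every finite generating set
    ¬ (∀ (H : Type) [Group H], Group.IsFinitelyPresented H → Infinite H →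
        ∀ A : Set H, A.Finite → Subgroup.closure A = ⊤ →
          ∃ N : ℕ, ∀ h : H, DeadEnd.deadEndDepth A h ≤ N) := by
  have depth : ∀ N : ℕ, ∃ g : DeadEnd.G, N ≤ DeadEnd.deadEndDepth DeadEnd.genSet g := fun N =>
    ⟨DeadEnd.gElt (N + 1), N.le_succ.trans (DeadEnd.le_deadEndDepth_gElt N.succ_pos)⟩
  have finite : DeadEnd.genSet.Finite := by simp [DeadEnd.genSet]
  refine ⟨⟨DeadEnd.isFinitelyPresented_G, DeadEnd.infinite_G, finite, DeadEnd.closure_genSet⟩,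
    fun n hn => ⟨DeadEnd.wordLength_gElt hn, DeadEnd.le_deadEndDepth_gElt hn⟩, depth, ?_⟩
  intro h
  obtain ⟨N, hN⟩ := h DeadEnd.G DeadEnd.isFinitelyPresented_G DeadEnd.infinite_G DeadEnd.genSet
    finite DeadEnd.closure_genSet
  obtain ⟨g, hg⟩ := depth (N + 1)
  exact absurd (hN g) (by omega)
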